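/- Let $n\ge 2$ and let $\Omega\subset\mathbb R^n$ be a bounded open set (for example a bounded connected Lipschitz domain). For $\delta>0$ put $\Omega_\delta=\bigcup_{x\in\Omega}B(x,\delta)$, and let $\omega_\delta:\mathbb R^n\to[0,\infty)$ be measurable and radial, with support in $B(0,\delta)$ and $$\int_{\mathbb R^n}|x|^2\omega_\delta(x)^2\,\mathrm dx=K_{2,n}^{-1},\qquad K_{p,n}=\frac1{|\mathbb S^{n-1}|}\int_{\mathbb S^{n-1}}|s\cdot e|^p\,\mathrm ds,\quad e\in\mathbb S^{n-1}.$$ Extending $u\in L^2(\Omega)$ by zero, let $\mathcal G_\delta u(x,x')=[u(x)-u(x')]\,\omega_\delta(x-x')$, regarded as an unbounded operator from $L^2(\Omega)$ to $L^2(\Omega_\delta\times\Omega_\delta)$ with domain $\mathbb U_{\delta,0}=\{u\in L^2(\Omega):\mathcal G_\delta u\in L^2(\Omega_\delta\times\Omega_\delta)\}$. Let $\mathcal D_\delta$ be its negative (Hilbert space) adjoint, that is, $(\mathcal D_\delta \ddot q,v)_{L^2(\Omega)}=-(\ddot q,\mathcal G_\delta v)_{L^2(\Omega_\delta\times\Omega_\delta)}$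 for all $v\in\mathbb U_{\delta,0}$, and let $\mathbb Q_\delta\subset L^2(\Omega_\delta\times\Omega_\delta)$ be the domain of $\mathcal D_\delta$, equipped with the graph inner product $$(\ddot q,\ddot p)_{\mathbb Q_\delta}=(\ddot q,\ddot p)_{L^2(\Omega_\delta\times\Omega_\delta)}+(\mathcal D_\delta\ddot q,\mathcal D_\delta\ddot p)_{L^2(\Omega)}.$$ Then, for every $\delta>0$, $\mathbb U_{\delta,0}$ is dense in $L^2(\Omega)$, so that $\mathcal D_\delta$ is well defined, and: 1. $\mathbb Q_\delta$ is dense in $L^2(\Omega_\delta\times\Omega_\delta)$. 2. $\mathbb Q_\delta$ is a Hilbert space. 3. $\mathcal D_\delta:\mathbb Q_\delta\to L^2(\Omega)$ is bounded and surjective. Moreover: 4. For every $\bar\delta>0$ there is a constant $C>0$ such that for each $v\in L^2(\Omega)$ and each $0<\delta<\bar\delta$ there is $\ddot q_{v,\delta}\in\mathbb Q_\delta$ with $\mathcal D_\delta\ddot q_{v,\delta}=v$ and $\|\ddot q_{v,\delta}\|_{\mathbb Q_\delta}\le C\|v\|_{L^2(\Omega)}$. -/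

import Mathlib

open MeasureTheory Set

noncomputable section

namespace NonlocalDiv

/-- `ℝⁿ` with the Euclidean norm. -/
abbrev E (n : ℕ) : Type := EuclideanSpace ℝ (Fin n)

/-- The constant `K_{p,n}`, the mean of `|s · e|^p` over the unit sphere of `ℝⁿ` with respect to
its surface measure, where `e` is a unit vector. -/
def sphereConst {n : ℕ} (p : ℝ) (e : Metric.sphere (0 : E n) 1) : ℝ :=
  ((volume : Measure (E n)).toSphere.real univ)⁻¹ *
    ∫ s : Metric.sphere (0 : E n) 1, |inner ℝ (s : E n) (e : E n)| ^ p
      ∂(volume : Measure (E n)).toSphere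

/-- Admissible interaction kernels of horizon `δ`: nonnegative measurable radial functions supported
in `B(0, δ)` with `∫ |x|² ω(x)² dx = K_{2,n}⁻¹`. The value of the integral being positive, the
integrand is in particular integrable. -/
structure IsKernel {n : ℕ} (e : Metric.sphere (0 : E n) 1) (δ : ℝ) (ω : E n → ℝ) : Prop where
  aemeasurable : AEMeasurable ω volume
  nonneg : ∀ x, 0 ≤ ω x
  radial : ∀ x y, ‖x‖ = ‖y‖ → ω x = ω y
  support_subset : Function.support ω ⊆ Metric.ball 0 δ
  normalized : ∫ x, ‖x‖ ^ 2 * ω x ^ 2 = (sphereConst 2 e)⁻¹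

/-- `Ω_δ`, the union of the balls `B(x, δ)`, `x ∈ Ω`. -/
def enlarge {n : ℕ} (Ω : Set (E n)) (δ : ℝ) : Set (E n) :=
  ⋃ x ∈ Ω, Metric.ball x δ

/-- `L²(Ω)`. -/
abbrev L2 {n : ℕ} (Ω : Set (E n)) : Type :=
  Lp ℝ 2 ((volume : Measure (E n)).restrict Ω)

/-- `L²(Ω_δ × Ω_δ)`. -/
abbrev L2Pair {n : ℕ} (Ω : Set (E n)) (δ : ℝ) : Type :=
  Lp ℝ 2 ((volume : Measure (E n × E n)).restrict (enlarge Ω δ ×ˢ enlarge Ω δ))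

/-- The two-point function `(x, x') ↦ [u(x) - u(x')] ω(x - x')`, where `u` is extended by zero
outside of `Ω`. -/
def gradFun {n : ℕ} (Ω : Set (E n)) (ω : E n → ℝ) (u : E n → ℝ) (z : E n × E n) : ℝ :=
  (Ω.indicator u z.1 - Ω.indicator u z.2) * ω (z.1 - z.2)

lemma ae_fst_snd {n : ℕ} {P : E n → Prop} (S : Set (E n × E n))
    (h : ∀ᵐ x ∂(volume : Measure (E n)), P x) :
    ∀ᵐ z ∂(volume : Measure (E n × E n)).restrict S, P z.1 ∧ P z.2 := by
  refine ae_restrict_of_ae ?_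
  rw [Measure.volume_eq_prod]
  exact (Measure.quasiMeasurePreserving_fst.ae h).and (Measure.quasiMeasurePreserving_snd.ae h)

lemma gradFun_add {n : ℕ} {Ω : Set (E n)} (hΩ : MeasurableSet Ω) (ω : E n → ℝ)
    (S : Set (E n × E n)) (u v : L2 Ω) :
    gradFun Ω ω (u + v : L2 Ω) =ᵐ[volume.restrict S] gradFun Ω ω u + gradFun Ω ω v := by
  have h := ae_fst_snd S ((ae_restrict_iff' hΩ).1 (Lp.coeFn_add u v))
  filter_upwards [h] with z hz
  have key : ∀ x, (x ∈ Ω → (u + v : L2 Ω) x = ((u : E n → ℝ) + v) x) →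
      Ω.indicator ((u + v : L2 Ω) : E n → ℝ) x = Ω.indicator u x + Ω.indicator v x := by
    intro x hx
    by_cases hxΩ : x ∈ Ω
    · simpa [hxΩ] using hx hxΩ
    · simp [hxΩ]
  simp only [gradFun, Pi.add_apply, key _ hz.1, key _ hz.2]
  ring

lemma gradFun_smul {n : ℕ} {Ω : Set (E n)} (hΩ : MeasurableSet Ω) (ω : E n → ℝ)
    (S : Set (E n × E n)) (c : ℝ) (u : L2 Ω) :
    gradFun Ω ω (c • u : L2 Ω) =ᵐ[volume.restrict S] c • gradFun Ω ω u := by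
  have h := ae_fst_snd S ((ae_restrict_iff' hΩ).1 (Lp.coeFn_smul c u))
  filter_upwards [h] with z hz
  have key : ∀ x, (x ∈ Ω → (c • u : L2 Ω) x = (c • (u : E n → ℝ)) x) →
      Ω.indicator ((c • u : L2 Ω) : E n → ℝ) x = c * Ω.indicator u x := by
    intro x hx
    by_cases hxΩ : x ∈ Ω
    · simpa [hxΩ] using hx hxΩ
    · simp [hxΩ]
  simp only [gradFun, Pi.smul_apply, smul_eq_mul, key _ hz.1, key _ hz.2]
  ring

lemma gradFun_zero {n : ℕ} {Ω : Set (E n)} (hΩ : MeasurableSet Ω) (ω : E n → ℝ)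
    (S : Set (E n × E n)) :
    gradFun Ω ω (0 : L2 Ω) =ᵐ[volume.restrict S] 0 := by
  simpa using gradFun_smul hΩ ω S 0 (0 : L2 Ω)

/-- The nonlocal gradient `𝒢_δ`, an unbounded operator from `L²(Ω)` to `L²(Ω_δ × Ω_δ)` whose domain
`𝕌_{δ,0}` consists of all `u ∈ L²(Ω)` for which the two-point function is in `L²(Ω_δ × Ω_δ)`. -/
def grad {n : ℕ} (Ω : Set (E n)) (hΩ : MeasurableSet Ω) (δ : ℝ) (ω : E n → ℝ) :
    L2 Ω →ₗ.[ℝ] L2Pair Ω δ where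
  domain :=
    { carrier := {u | MemLp (gradFun Ω ω u) 2
        ((volume : Measure (E n × E n)).restrict (enlarge Ω δ ×ˢ enlarge Ω δ))}
      zero_mem' := (memLp_congr_ae (gradFun_zero hΩ ω _)).2 MemLp.zero
      add_mem' := fun {u v} hu hv => (memLp_congr_ae (gradFun_add hΩ ω _ u v)).2 (hu.add hv)
      smul_mem' := fun c u hu => (memLp_congr_ae (gradFun_smul hΩ ω _ c u)).2 (hu.const_smul c) }
  toFun :=
    { toFun := fun u => MemLp.toLp (gradFun Ω ω (u : L2 Ω)) u.2
      map_add' := fun u v => by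
        rw [← MemLp.toLp_add]
        exact MemLp.toLp_congr _ _ (gradFun_add hΩ ω _ u v)
      map_smul' := fun c u => by
        rw [RingHom.id_apply, ← MemLp.toLp_const_smul]
        exact MemLp.toLp_congr _ _ (gradFun_smul hΩ ω _ c u) }

/-- The nonlocal divergence `𝒟_δ`, the negative adjoint of `𝒢_δ`. -/
def div {n : ℕ} (Ω : Set (E n)) (hΩ : MeasurableSet Ω) (δ : ℝ) (ω : E n → ℝ) :
    L2Pair Ω δ →ₗ.[ℝ] L2 Ω :=
  -(grad Ω hΩ δ ω).adjoint

/-- The space `ℚ_δ`, the domain of `𝒟_δ`. It is a type synonym, so that it can carry the graph inner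
product in place of the one of `L²(Ω_δ × Ω_δ)`. -/
def Flux {n : ℕ} (Ω : Set (E n)) (hΩ : MeasurableSet Ω) (δ : ℝ) (ω : E n → ℝ) : Type :=
  (div Ω hΩ δ ω).domain

section Flux

variable {n : ℕ} (Ω : Set (E n)) (hΩ : MeasurableSet Ω) (δ : ℝ) (ω : E n → ℝ)

instance : AddCommGroup (Flux Ω hΩ δ ω) := inferInstanceAs (AddCommGroup (div Ω hΩ δ ω).domain)

instance : Module ℝ (Flux Ω hΩ δ ω) := inferInstanceAs (Module ℝ (div Ω hΩ δ ω).domain)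

/-- The inclusion of `ℚ_δ` into `L²(Ω_δ × Ω_δ)`. -/
def Flux.incl : Flux Ω hΩ δ ω →ₗ[ℝ] L2Pair Ω δ := (div Ω hΩ δ ω).domain.subtype

/-- `𝒟_δ` as an everywhere defined linear map on `ℚ_δ`. -/
def Flux.div : Flux Ω hΩ δ ω →ₗ[ℝ] L2 Ω := (NonlocalDiv.div Ω hΩ δ ω).toFun

/-- The graph inner product `(q, p)_{L²(Ω_δ × Ω_δ)} + (𝒟_δ q, 𝒟_δ p)_{L²(Ω)}`. -/
@[reducible] def Flux.core : InnerProductSpace.Core ℝ (Flux Ω hΩ δ ω) where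
  inner q p := inner ℝ (Flux.incl Ω hΩ δ ω q) (Flux.incl Ω hΩ δ ω p) +
    inner ℝ (Flux.div Ω hΩ δ ω q) (Flux.div Ω hΩ δ ω p)
  conj_inner_symm q p := by
    simp only [conj_trivial]
    rw [real_inner_comm, real_inner_comm (Flux.div Ω hΩ δ ω q)]
  re_inner_nonneg q := add_nonneg real_inner_self_nonneg real_inner_self_nonneg
  add_left q p r := by
    simp only [map_add, inner_add_left]
    ring
  smul_left q p c := by
    simp only [map_smul, real_inner_smul_left, conj_trivial]
    ring
  definite q h := by
    have h1 : 0 ≤ inner ℝ (Flux.incl Ω hΩ δ ω q) (Flux.incl Ω hΩ δ ω q) := real_inner_self_nonneg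
    have h2 : 0 ≤ inner ℝ (Flux.div Ω hΩ δ ω q) (Flux.div Ω hΩ δ ω q) := real_inner_self_nonneg
    have h3 : inner ℝ (Flux.incl Ω hΩ δ ω q) (Flux.incl Ω hΩ δ ω q) = 0 := by linarith
    exact Subtype.ext (inner_self_eq_zero.1 h3)

instance : NormedAddCommGroup (Flux Ω hΩ δ ω) :=
  (Flux.core Ω hΩ δ ω).toNormedAddCommGroup

instance : InnerProductSpace ℝ (Flux Ω hΩ δ ω) :=
  InnerProductSpace.ofCore (Flux.core Ω hΩ δ ω).toCore

lemma Flux.inner_def (q p : Flux Ω hΩ δ ω) :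
    inner ℝ q p = inner ℝ (Flux.incl Ω hΩ δ ω q) (Flux.incl Ω hΩ δ ω p) +
      inner ℝ (Flux.div Ω hΩ δ ω q) (Flux.div Ω hΩ δ ω p) := rfl

end Flux

end NonlocalDiv

end

/-! Everything follows from the duality theory of unbounded operators once `grad` is known to be
densely defined, closed and bounded below. Closedness of `grad` makes its adjoint densely defined;
density of its domain makes the adjoint closed, so the graph norm is complete; a bound `‖u‖ ≤ C
‖grad u‖` makes the adjoint surjective with preimages of norm at most `C ‖v‖`.

The analytic core is the lower bound, `IsKernel.poincare`. If `Ω` lies in a ball of radius `R`, then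
about `2R/|h|` shifts by `h` move the zero extension of `u` off its own support, so `|h| ‖u‖ ≤ (2R +
d) ‖u(· + h) - u‖` whenever `|h| ≤ d`. Squaring, multiplying by `ω(h)²` and integrating in `h`, the
normalization of `ω` turns the left side into `‖u‖² / K` and the right side into the squared norm of
the nonlocal gradient. Only `d ≥ δ` enters the constant, which gives uniformity in `δ`. -/

namespace LinearPMap

/-! ### Adjoints of unbounded operators between Hilbert spaces -/

variable {X Y : Type*} [NormedAddCommGroup X] [InnerProductSpace ℝ X] [CompleteSpace X]
  [NormedAddCommGroup Y] [InnerProductSpace ℝ Y] [CompleteSpace Y]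

/-- The adjoint of a closed operator is densely defined. -/
theorem IsClosed.dense_adjoint_domain {T : X →ₗ.[ℝ] Y} (hT : T.IsClosed) :
    Dense (T.adjoint.domain : Set Y) := by
  rw [Submodule.dense_iff_topologicalClosure_eq_top, Submodule.topologicalClosure_eq_top_iff,
    Submodule.eq_bot_iff]
  intro y hy
  by_contra hy0
  have hmem : ((0 : X), y) ∉ T.graph := by
    intro h
    exact hy0 (T.graph_fst_eq_zero_snd h rfl)
  -- A functional separates `(0, y)` from the closed graph. Being bounded above on a subspace, it
  -- vanishes there.
  obtain ⟨f, c, hfc, hfy⟩ := geometric_hahn_banach_closed_point T.graph.convex hT hmem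
  have hc : 0 < c := by simpa using hfc 0 T.graph.zero_mem
  have hf : ∀ z ∈ T.graph, f z = 0 := by
    intro z hz
    by_contra h0
    have := hfc (((c + 1) / f z) • z) (T.graph.smul_mem _ hz)
    rw [f.map_smul, smul_eq_mul, div_mul_cancel₀ _ h0] at this
    linarith
  let a := (InnerProductSpace.toDual ℝ X).symm (f.comp (.inl ℝ X Y))
  let b := (InnerProductSpace.toDual ℝ Y).symm (f.comp (.inr ℝ X Y))
  have ha : ∀ x, inner ℝ a x = f (x, 0) := fun x => InnerProductSpace.toDual_symm_apply
  have hb' : ∀ z, inner ℝ b z = f (0, z) := fun z => InnerProductSpace.toDual_symm_apply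
  -- Vanishing on the graph reads `⟪a, x⟫ + ⟪b, T x⟫ = 0`, so the adjoint sends `b` to `-a`. But
  -- `⟪b, y⟫ = f (0, y) > 0`, although `y` is orthogonal to the adjoint's domain.
  have hb : b ∈ T.adjoint.domain := by
    refine mem_adjoint_domain_of_exists b ⟨-a, fun x => ?_⟩
    have h := hf _ (T.mem_graph x)
    rw [← Prod.fst_add_snd ((x : X), T x), f.map_add, ← ha, ← hb'] at h
    rw [inner_neg_left]
    linarith
  have h := hy b hb
  rw [hb'] at h
  linarith

/-- A lower bound `‖u‖ ≤ C ‖T u‖` makes the adjoint of `T` surjective, with bounded preimages. -/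
theorem exists_adjoint_apply_eq {T : X →ₗ.[ℝ] Y} (hd : Dense (T.domain : Set X)) {C : ℝ}
    (hC : 0 ≤ C) (hT : ∀ u : T.domain, ‖(u : X)‖ ≤ C * ‖T u‖) (v : X) :
    ∃ q : T.adjoint.domain, T.adjoint q = v ∧ ‖(q : Y)‖ ≤ C * ‖v‖ := by
  have hinj : LinearMap.ker T.toFun = ⊥ := by
    rw [LinearMap.ker_eq_bot']
    intro u hu
    have := hT u
    rw [show T u = 0 from hu, norm_zero, mul_zero] at this
    exact Subtype.ext (norm_le_zero_iff.1 this)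
  let eqv := LinearEquiv.ofInjective T.toFun (LinearMap.ker_eq_bot.1 hinj)
  have heqv : ∀ w : LinearMap.range T.toFun, T (eqv.symm w) = w := fun w =>
    congrArg Subtype.val (eqv.apply_symm_apply w)
  -- The functional `T u ↦ ⟪v, u⟫` on the range is bounded by the lower bound on `T`; a
  -- norm-preserving extension and Riesz representation give `q`.
  let f : StrongDual ℝ (LinearMap.range T.toFun) :=
    ((innerₛₗ ℝ v).comp (T.domain.subtype.comp eqv.symm.toLinearMap)).mkContinuous (C * ‖v‖) <| by
      intro w
      have h1 : ‖inner ℝ v (eqv.symm w : X)‖ ≤ ‖v‖ * ‖(eqv.symm w : X)‖ := norm_inner_le_norm _ _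
      have h2 := hT (eqv.symm w)
      rw [heqv] at h2
      calc _ ≤ ‖v‖ * ‖(eqv.symm w : X)‖ := h1
        _ ≤ ‖v‖ * (C * ‖(w : Y)‖) := by gcongr
        _ = C * ‖v‖ * ‖w‖ := by rw [Submodule.coe_norm]; ring
  obtain ⟨g, hg, hgn⟩ := exists_extension_norm_eq _ f
  let q : Y := (InnerProductSpace.toDual ℝ Y).symm g
  have hq : ∀ u : T.domain, inner ℝ v (u : X) = inner ℝ q (T u) := by
    intro u
    have h1 : inner ℝ q (T u) = g (T u) := InnerProductSpace.toDual_symm_apply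
    have h2 := hg ⟨T u, ⟨u, rfl⟩⟩
    have h3 : f ⟨T u, ⟨u, rfl⟩⟩ = inner ℝ v (eqv.symm (eqv u) : X) := rfl
    rw [h1, h2, h3, eqv.symm_apply_apply]
  refine ⟨⟨q, mem_adjoint_domain_of_exists q ⟨v, hq⟩⟩, adjoint_apply_eq hd _ hq, ?_⟩
  calc ‖q‖ = ‖g‖ := LinearIsometryEquiv.norm_map _ _
    _ = ‖f‖ := hgn
    _ ≤ C * ‖v‖ := LinearMap.mkContinuous_norm_le _ (by positivity) _

end LinearPMap

namespace NonlocalDiv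

/-! ### Translation estimates -/

section Translation

variable {V : Type*} [NormedAddCommGroup V] [MeasurableSpace V] {μ : Measure V} {p : ENNReal}
  {f : V → ℝ}

/-- The difference telescopes into `k` translates of `f (· + h) - f`, all of the same norm. -/
theorem eLpNorm_translate_nsmul_sub_le [BorelSpace V] [μ.IsAddRightInvariant] (hp : 1 ≤ p) (hf : Measurable f) (h : V) (k : ℕ) :
    eLpNorm (fun x => f (x + k • h) - f x) p μ ≤ k * eLpNorm (fun x => f (x + h) - f x) p μ := by
  have hm : Measurable fun x => f (x + h) - f x := by fun_prop
  induction k with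
  | zero => simp
  | succ k ih =>
    have h1 : eLpNorm (fun x => f (x + k • h + h) - f (x + k • h)) p μ =
        eLpNorm (fun x => f (x + h) - f x) p μ :=
      eLpNorm_comp_measurePreserving (g := fun x => f (x + h) - f x) (f := fun x => x + k • h)
        hm.aestronglyMeasurable (measurePreserving_add_right μ (k • h))
    have h2 : (fun x => f (x + (k + 1) • h) - f x) =
        (fun x => f (x + k • h) - f x) + fun x => f (x + k • h + h) - f (x + k • h) := by
      ext x
      simp [add_smul, add_assoc]
    rw [h2]
    refine (eLpNorm_add_le (Measurable.aestronglyMeasurable (by fun_prop))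
      (Measurable.aestronglyMeasurable (by fun_prop)) hp).trans ?_
    rw [h1, Nat.cast_add, Nat.cast_one, add_mul, one_mul]
    gcongr

/-- Wherever `f x ≠ 0`, the shifted value vanishes, so the difference has absolute value `|f x|`. -/
theorem eLpNorm_le_translate_sub {S : Set V} (hS : Function.support f ⊆ S) {w : V}
    (hw : ∀ x ∈ S, x + w ∉ S) :
    eLpNorm f p μ ≤ eLpNorm (fun x => f (x + w) - f x) p μ := by
  refine eLpNorm_mono fun x => ?_
  by_cases hx : f x = 0
  · simp [hx]
  · have : f (x + w) = 0 := by
      by_contra h0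
      exact hw x (hS hx) (hS h0)
    simp [this]

/-- Translating a function supported in a ball of radius `R` by multiples of `h` until the supports
are disjoint bounds it by its increment with step `h`. -/
theorem norm_mul_eLpNorm_le_translate_sub [NormedSpace ℝ V] [BorelSpace V]
    [μ.IsAddRightInvariant] (hp : 1 ≤ p) (hf : Measurable f) {R d : ℝ} (hR : 0 < R)
    (hS : Function.support f ⊆ Metric.ball 0 R) {h : V} (hd : ‖h‖ ≤ d) :
    ‖h‖ₑ * eLpNorm f p μ ≤
      ENNReal.ofReal (2 * R + d) * eLpNorm (fun x => f (x + h) - f x) p μ := by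
  rcases eq_or_ne h 0 with rfl | h0
  · simp
  have hh : 0 < ‖h‖ := norm_pos_iff.2 h0
  -- The fewest steps covering the diameter `2R`; rounding up costs at most one extra step, of
  -- length at most `d`.
  set k := ⌈2 * R / ‖h‖⌉₊
  have hk1 : 2 * R ≤ k * ‖h‖ := by
    rw [← div_le_iff₀ hh]
    exact Nat.le_ceil _
  have hk2 : ‖h‖ * k ≤ 2 * R + d := by
    have : (k : ℝ) < 2 * R / ‖h‖ + 1 := Nat.ceil_lt_add_one (by positivity)
    calc ‖h‖ * k ≤ ‖h‖ * (2 * R / ‖h‖ + 1) := by gcongr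
      _ = 2 * R + ‖h‖ := by field_simp
      _ ≤ _ := by gcongr
  have hw : ∀ x ∈ Metric.ball (0 : V) R, x + k • h ∉ Metric.ball (0 : V) R := by
    intro x hx hx'
    rw [mem_ball_zero_iff] at hx hx'
    have : ‖k • h‖ ≤ ‖x + k • h‖ + ‖x‖ := by
      simpa using norm_sub_le (x + k • h) x
    rw [← Nat.cast_smul_eq_nsmul ℝ, norm_smul, Real.norm_natCast,
      Nat.cast_smul_eq_nsmul ℝ] at this
    linarith
  calc ‖h‖ₑ * eLpNorm f p μ
      ≤ ‖h‖ₑ * (k * eLpNorm (fun x => f (x + h) - f x) p μ) := by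
        gcongr
        exact (eLpNorm_le_translate_sub hS hw).trans (eLpNorm_translate_nsmul_sub_le hp hf h k)
    _ = ENNReal.ofReal (‖h‖ * k) * eLpNorm (fun x => f (x + h) - f x) p μ := by
        rw [ENNReal.ofReal_mul (norm_nonneg h), ofReal_norm, ENNReal.ofReal_natCast,
          mul_assoc]
    _ ≤ _ := by gcongr

/-- Substituting `x = y + h` makes a kernel in `x - y` depend on the outer variable alone. -/
theorem lintegral_prod_eq_lintegral_translate [BorelSpace V]
    [SecondCountableTopology V] [μ.IsAddRightInvariant] [SFinite μ] {F : V × V → ENNReal}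
    (hF : Measurable F) :
    ∫⁻ z, F z ∂μ.prod μ = ∫⁻ h, ∫⁻ y, F (y + h, y) ∂μ ∂μ := by
  rw [lintegral_prod_symm F hF.aemeasurable]
  have h1 : ∀ y, ∫⁻ x, F (x, y) ∂μ = ∫⁻ x, F (x + y, y) ∂μ := fun y =>
    (lintegral_add_right_eq_self (fun x => F (x, y)) y).symm
  simp_rw [h1]
  rw [lintegral_lintegral_swap (Measurable.aemeasurable (by fun_prop))]
  simp_rw [add_comm]

end Translation

theorem eLpNorm_two_sq {α : Type*} [MeasurableSpace α] (f : α → ℝ) (μ : Measure α) :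
    eLpNorm f 2 μ ^ 2 = ∫⁻ x, ‖f x‖ₑ ^ 2 ∂μ := by
  simpa using eLpNorm_nnreal_pow_eq_lintegral (μ := μ) (f := f) (p := 2) two_ne_zero

/-- The integrand is continuous, nonnegative and equal to `1` at `s = e`. -/
theorem sphereConst_two_pos {n : ℕ} (e : Metric.sphere (0 : E n) 1) : 0 < sphereConst 2 e := by
  have : Nontrivial (E n) := ⟨⟨e, 0, fun h => by simpa [h] using norm_eq_of_mem_sphere e⟩⟩
  have hne : (volume : Measure (E n)).toSphere ≠ 0 := Measure.toSphere_ne_zero _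
  refine mul_pos (inv_pos.2 (ENNReal.toReal_pos (Measure.measure_univ_ne_zero.2 hne) (measure_ne_top _ _))) ?_
  refine Continuous.integral_pos_of_hasCompactSupport_nonneg_nonzero (x := e) ?_ ?_ ?_ ?_
  · simp only [Real.rpow_two]
    fun_prop
  · exact HasCompactSupport.of_compactSpace _
  · intro s
    positivity
  · simp

theorem IsKernel.lintegral {n : ℕ} {e : Metric.sphere (0 : E n) 1} {δ : ℝ} {ω : E n → ℝ}
    (hω : IsKernel e δ ω) :
    ∫⁻ h, ‖h‖ₑ ^ 2 * ‖ω h‖ₑ ^ 2 = ENNReal.ofReal (sphereConst 2 e)⁻¹ := by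
  have hint : Integrable fun x => ‖x‖ ^ 2 * ω x ^ 2 := by
    by_contra h
    have := hω.normalized
    rw [integral_undef h] at this
    -- A non-integrable function would have Bochner integral `0`, not the positive `K⁻¹`.
    exact (inv_pos.2 (sphereConst_two_pos e)).ne this
  rw [← hω.normalized, ofReal_integral_eq_lintegral_ofReal hint
    (Filter.Eventually.of_forall fun x => by positivity)]
  refine lintegral_congr fun x => ?_
  rw [ENNReal.ofReal_mul (by positivity), ENNReal.ofReal_pow (norm_nonneg x),
    ENNReal.ofReal_pow (hω.nonneg x), ofReal_norm, Real.enorm_eq_ofReal (hω.nonneg x)]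

/-! ### The nonlocal gradient: Poincaré inequality and Lipschitz functions -/

section Gradient

variable {n : ℕ} {Ω : Set (E n)} {δ : ℝ} {ω ω' : E n → ℝ} {u v : E n → ℝ}

theorem gradFun_congr_kernel (h : ω =ᵐ[volume] ω') (u : E n → ℝ) :
    gradFun Ω ω u =ᵐ[volume] gradFun Ω ω' u := by
  rw [Measure.volume_eq_prod]
  filter_upwards [(quasiMeasurePreserving_sub (volume : Measure (E n)) volume).ae_eq_comp h]
    with z hz
  simp only [Function.comp_apply] at hz
  simp only [gradFun, hz]

theorem indicator_ae_eq (hΩ : MeasurableSet Ω) (h : u =ᵐ[volume.restrict Ω] v) :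
    ∀ᵐ x ∂(volume : Measure (E n)), Ω.indicator u x = Ω.indicator v x := by
  filter_upwards [(ae_restrict_iff' hΩ).1 h] with x hx
  by_cases hxΩ : x ∈ Ω
  · simp [hxΩ, hx hxΩ]
  · simp [hxΩ]

theorem gradFun_congr (hΩ : MeasurableSet Ω) (S : Set (E n × E n))
    (h : u =ᵐ[volume.restrict Ω] v) :
    gradFun Ω ω u =ᵐ[volume.restrict S] gradFun Ω ω v := by
  filter_upwards [ae_fst_snd S (indicator_ae_eq hΩ h)] with z hz
  simp only [gradFun, hz.1, hz.2]

theorem measurable_gradFun (hΩ : MeasurableSet Ω) (hω : Measurable ω) (hu : Measurable u) :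
    Measurable (gradFun Ω ω u) := by
  have := hu.indicator hΩ
  unfold gradFun
  fun_prop

theorem aestronglyMeasurable_gradFun (hΩ : MeasurableSet Ω) (hω : AEMeasurable ω)
    (hu : Measurable u) : AEStronglyMeasurable (gradFun Ω ω u) volume :=
  ⟨gradFun Ω (hω.mk ω) u, (measurable_gradFun hΩ hω.measurable_mk hu).stronglyMeasurable,
    gradFun_congr_kernel hω.ae_eq_mk u⟩

theorem isBounded_enlarge (hb : Bornology.IsBounded Ω) (δ : ℝ) :
    Bornology.IsBounded (enlarge Ω δ) := by
  obtain ⟨R, hR⟩ := hb.subset_ball 0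
  refine Metric.isBounded_ball (x := (0 : E n)) (r := R + δ) |>.subset ?_
  intro y hy
  obtain ⟨x, hx, hxy⟩ := mem_iUnion₂.1 hy
  have := hR hx
  rw [Metric.mem_ball] at *
  linarith [dist_triangle y x 0]

/-- A nonzero value needs one point in `Ω` and the other within `δ` of it. Hence integrating over
`Ω_δ × Ω_δ` or over the whole space gives the same. -/
theorem support_gradFun_subset (hδ : 0 < δ) (hω : Function.support ω ⊆ Metric.ball 0 δ) :
    Function.support (gradFun Ω ω u) ⊆ enlarge Ω δ ×ˢ enlarge Ω δ := by
  intro z hz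
  have h1 : ω (z.1 - z.2) ≠ 0 := right_ne_zero_of_mul hz
  have h2 : ‖z.1 - z.2‖ < δ := mem_ball_zero_iff.1 (hω h1)
  have h3 : z.1 ∈ Ω ∨ z.2 ∈ Ω := by
    by_contra! h
    exact left_ne_zero_of_mul hz (by simp [h.1, h.2])
  rcases h3 with h | h
  · exact ⟨mem_iUnion₂.2 ⟨z.1, h, Metric.mem_ball_self hδ⟩,
      mem_iUnion₂.2 ⟨z.1, h, by rwa [Metric.mem_ball', dist_eq_norm]⟩⟩
  · exact ⟨mem_iUnion₂.2 ⟨z.2, h, by rwa [Metric.mem_ball, dist_eq_norm]⟩,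
      mem_iUnion₂.2 ⟨z.2, h, Metric.mem_ball_self hδ⟩⟩

theorem lintegral_gradFun (hΩ : MeasurableSet Ω) (hω : AEMeasurable ω) (hu : Measurable u) :
    ∫⁻ z, ‖gradFun Ω ω u z‖ₑ ^ 2 =
      ∫⁻ h, ‖ω h‖ₑ ^ 2 * ∫⁻ y, ‖Ω.indicator u (y + h) - Ω.indicator u y‖ₑ ^ 2 := by
  have hui := hu.indicator hΩ
  have h1 : ∫⁻ z, ‖gradFun Ω ω u z‖ₑ ^ 2 = ∫⁻ z, ‖gradFun Ω (hω.mk ω) u z‖ₑ ^ 2 :=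
    lintegral_congr_ae ((gradFun_congr_kernel hω.ae_eq_mk u).fun_comp fun t => ‖t‖ₑ ^ 2)
  have hm := measurable_gradFun hΩ hω.measurable_mk hu
  rw [h1, Measure.volume_eq_prod, lintegral_prod_eq_lintegral_translate (by fun_prop)]
  refine lintegral_congr_ae ?_
  filter_upwards [hω.ae_eq_mk] with h hh
  rw [hh, ← lintegral_const_mul _ (by fun_prop)]
  refine lintegral_congr fun y => ?_
  simp only [gradFun, add_sub_cancel_left, enorm_mul, mul_pow, mul_comm]

/-- The nonlocal Poincaré inequality, with a constant depending on the horizon only through an upper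
bound for it. -/
theorem IsKernel.poincare {e : Metric.sphere (0 : E n) 1} (hω : IsKernel e δ ω) (hδ : 0 < δ)
    (hΩ : MeasurableSet Ω) (hu : Measurable u) {R d : ℝ} (hR : 0 < R)
    (hΩR : Ω ⊆ Metric.ball 0 R) (hd : δ ≤ d) :
    eLpNorm u 2 (volume.restrict Ω) ≤
      ENNReal.ofReal (√(sphereConst 2 e) * (2 * R + d)) * eLpNorm (gradFun Ω ω u) 2
        (volume.restrict (enlarge Ω δ ×ˢ enlarge Ω δ)) := by
  have hK := sphereConst_two_pos e
  have hui := hu.indicator hΩ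
  have hsupp : Function.support (Ω.indicator u) ⊆ Metric.ball 0 R :=
    support_indicator_subset.trans hΩR
  set A := eLpNorm (Ω.indicator u) 2 volume with hA
  have hpt : ∀ h, A ^ 2 * (‖h‖ₑ ^ 2 * ‖ω h‖ₑ ^ 2) ≤ ENNReal.ofReal (2 * R + d) ^ 2 *
      (‖ω h‖ₑ ^ 2 * ∫⁻ y, ‖Ω.indicator u (y + h) - Ω.indicator u y‖ₑ ^ 2) := by
    intro h
    rcases eq_or_ne (ω h) 0 with h0 | h0
    · simp [h0]
    have hh : ‖h‖ ≤ d := (mem_ball_zero_iff.1 (hω.support_subset h0)).le.trans hd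
    have := norm_mul_eLpNorm_le_translate_sub (μ := volume) one_le_two hui hR hsupp hh
    rw [← eLpNorm_two_sq]
    calc _ = ‖ω h‖ₑ ^ 2 * (‖h‖ₑ * A) ^ 2 := by ring
      _ ≤ ‖ω h‖ₑ ^ 2 * (ENNReal.ofReal (2 * R + d) *
          eLpNorm (fun x => Ω.indicator u (x + h) - Ω.indicator u x) 2 volume) ^ 2 := by gcongr
      _ = _ := by ring
  have hint : A ^ 2 * ENNReal.ofReal (sphereConst 2 e)⁻¹ ≤
      ENNReal.ofReal (2 * R + d) ^ 2 * ∫⁻ z, ‖gradFun Ω ω u z‖ₑ ^ 2 := by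
    have hm : AEMeasurable (fun h => ‖h‖ₑ ^ 2 * ‖ω h‖ₑ ^ 2) volume := by
      have := hω.aemeasurable
      fun_prop
    have hm2 : Measurable fun z : E n × E n =>
        ‖Ω.indicator u (z.2 + z.1) - Ω.indicator u z.2‖ₑ ^ 2 := by fun_prop
    have hm3 : AEMeasurable (fun h => ‖ω h‖ₑ ^ 2 *
        ∫⁻ y, ‖Ω.indicator u (y + h) - Ω.indicator u y‖ₑ ^ 2) volume := by
      have := hω.aemeasurable
      have h2 := hm2.lintegral_prod_right' (ν := (volume : Measure (E n)))
      exact (by fun_prop : AEMeasurable (fun h => ‖ω h‖ₑ ^ 2) volume).mul h2.aemeasurable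
    rw [← hω.lintegral, lintegral_gradFun hΩ hω.aemeasurable hu, ← lintegral_const_mul'' _ hm,
      ← lintegral_const_mul'' _ hm3]
    exact lintegral_mono hpt
  have hset : ∫⁻ z, ‖gradFun Ω ω u z‖ₑ ^ 2 = eLpNorm (gradFun Ω ω u) 2
      (volume.restrict (enlarge Ω δ ×ˢ enlarge Ω δ)) ^ 2 := by
    rw [eLpNorm_two_sq]
    refine (setLIntegral_eq_of_support_subset ?_).symm
    refine Subset.trans ?_ (support_gradFun_subset (u := u) hδ hω.support_subset)
    intro z hz hz0
    exact hz (by simp [hz0])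
  rw [← eLpNorm_indicator_eq_eLpNorm_restrict hΩ, ← hA]
  rw [hset] at hint
  refine (ENNReal.pow_le_pow_left_iff two_ne_zero).1 ?_
  have hone : ENNReal.ofReal (sphereConst 2 e)⁻¹ * ENNReal.ofReal (sphereConst 2 e) = 1 := by
    rw [← ENNReal.ofReal_mul (by positivity), inv_mul_cancel₀ hK.ne', ENNReal.ofReal_one]
  calc A ^ 2 = A ^ 2 * ENNReal.ofReal (sphereConst 2 e)⁻¹ * ENNReal.ofReal (sphereConst 2 e) := by
        rw [mul_assoc, hone, mul_one]
    _ ≤ ENNReal.ofReal (2 * R + d) ^ 2 * eLpNorm (gradFun Ω ω u) 2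
          (volume.restrict (enlarge Ω δ ×ˢ enlarge Ω δ)) ^ 2 *
          ENNReal.ofReal (sphereConst 2 e) := by gcongr
    _ = _ := by
        rw [mul_pow, ENNReal.ofReal_mul (Real.sqrt_nonneg _), mul_pow,
          ← ENNReal.ofReal_pow (Real.sqrt_nonneg _), Real.sq_sqrt hK.le]
        ring

/-- Lipschitz functions have square integrable nonlocal gradients. -/
theorem IsKernel.memLp_gradFun {e : Metric.sphere (0 : E n) 1} (hω : IsKernel e δ ω)
    (hΩ : MeasurableSet Ω) (hb : Bornology.IsBounded Ω) (hu : Measurable u) {L : NNReal}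
    (hL : LipschitzWith L (Ω.indicator u)) :
    MemLp (gradFun Ω ω u) 2 (volume.restrict (enlarge Ω δ ×ˢ enlarge Ω δ)) := by
  refine ⟨(aestronglyMeasurable_gradFun hΩ hω.aemeasurable hu).restrict, ?_⟩
  let φ : E n → ENNReal := fun h => L ^ 2 * (‖h‖ₑ ^ 2 * ‖ω h‖ₑ ^ 2)
  have hm : AEMeasurable (fun h => ‖h‖ₑ ^ 2 * ‖ω h‖ₑ ^ 2) volume := by
    have := hω.aemeasurable
    fun_prop
  have hφ : ∫⁻ h, φ h = L ^ 2 * ENNReal.ofReal (sphereConst 2 e)⁻¹ := by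
    rw [lintegral_const_mul'' _ hm, hω.lintegral]
  have hmφ : AEMeasurable (fun z : E n × E n => φ (z.1 - z.2))
      ((volume : Measure (E n)).prod (volume.restrict (enlarge Ω δ))) :=
    (hm.const_mul _).comp_quasiMeasurePreserving (quasiMeasurePreserving_sub _ _)
  have hpt : ∀ z, ‖gradFun Ω ω u z‖ₑ ^ 2 ≤ φ (z.1 - z.2) := by
    intro z
    have h1 : ‖Ω.indicator u z.1 - Ω.indicator u z.2‖ₑ ≤ L * ‖z.1 - z.2‖ₑ := by
      simpa only [edist_eq_enorm_sub] using hL z.1 z.2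
    calc ‖gradFun Ω ω u z‖ₑ ^ 2
        = ‖Ω.indicator u z.1 - Ω.indicator u z.2‖ₑ ^ 2 * ‖ω (z.1 - z.2)‖ₑ ^ 2 := by
          rw [gradFun, enorm_mul, mul_pow]
      _ ≤ (L * ‖z.1 - z.2‖ₑ) ^ 2 * ‖ω (z.1 - z.2)‖ₑ ^ 2 := by gcongr
      _ = φ (z.1 - z.2) := by simp only [φ]; ring
  have hfin : eLpNorm (gradFun Ω ω u) 2
      (volume.restrict (enlarge Ω δ ×ˢ enlarge Ω δ)) ^ 2 < ⊤ := by
    rw [eLpNorm_two_sq]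
    calc ∫⁻ z in enlarge Ω δ ×ˢ enlarge Ω δ, ‖gradFun Ω ω u z‖ₑ ^ 2
        -- Only the first factor is enlarged: the inner integral becomes the kernel's normalization,
        -- while the outer one runs over a bounded set.
        ≤ ∫⁻ z in univ ×ˢ enlarge Ω δ, φ (z.1 - z.2) :=
          lintegral_mono' (Measure.restrict_mono (prod_mono_left (subset_univ _)) le_rfl) hpt
      _ = ∫⁻ y in enlarge Ω δ, ∫⁻ x, φ (x - y) := by
          rw [Measure.volume_eq_prod, ← Measure.prod_restrict, Measure.restrict_univ,
            lintegral_prod_symm _ hmφ]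
      _ = volume (enlarge Ω δ) * (L ^ 2 * ENNReal.ofReal (sphereConst 2 e)⁻¹) := by
          simp_rw [lintegral_sub_right_eq_self φ, hφ, setLIntegral_const, mul_comm]
      _ < ⊤ := ENNReal.mul_lt_top (isBounded_enlarge hb δ).measure_lt_top
          (ENNReal.mul_lt_top (ENNReal.pow_lt_top ENNReal.coe_lt_top) ENNReal.ofReal_lt_top)
  exact (ENNReal.pow_lt_top_iff.1 hfin).resolve_right two_ne_zero

end Gradient

/-! ### Density, closedness, completeness and surjectivity for the operators -/

section Operators

variable {n : ℕ} {Ω : Set (E n)} {δ : ℝ} {ω : E n → ℝ}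

theorem mem_grad_domain {hΩ : MeasurableSet Ω} {u : L2 Ω} :
    u ∈ (grad Ω hΩ δ ω).domain ↔ MemLp (gradFun Ω ω u) 2
      ((volume : Measure (E n × E n)).restrict (enlarge Ω δ ×ˢ enlarge Ω δ)) := Iff.rfl

theorem coeFn_grad (hΩ : MeasurableSet Ω) (u : (grad Ω hΩ δ ω).domain) :
    (grad Ω hΩ δ ω u : E n × E n → ℝ)
      =ᵐ[volume.restrict (enlarge Ω δ ×ˢ enlarge Ω δ)] gradFun Ω ω (u : L2 Ω) :=
  MemLp.coeFn_toLp (mem_grad_domain.1 u.2)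

theorem IsKernel.norm_le_norm_grad {e : Metric.sphere (0 : E n) 1} (hω : IsKernel e δ ω)
    (hδ : 0 < δ) (hΩ : MeasurableSet Ω) {R d : ℝ} (hR : 0 < R) (hΩR : Ω ⊆ Metric.ball 0 R)
    (hd : δ ≤ d) (u : (grad Ω hΩ δ ω).domain) :
    ‖(u : L2 Ω)‖ ≤ √(sphereConst 2 e) * (2 * R + d) * ‖grad Ω hΩ δ ω u‖ := by
  have h := hω.poincare hδ hΩ (Lp.stronglyMeasurable (u : L2 Ω)).measurable hR hΩR hd
  have hu := mem_grad_domain.1 u.2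
  have hfin : ENNReal.ofReal (√(sphereConst 2 e) * (2 * R + d)) * eLpNorm (gradFun Ω ω (u : L2 Ω)) 2
        (volume.restrict (enlarge Ω δ ×ˢ enlarge Ω δ)) ≠ ⊤ :=
    ENNReal.mul_ne_top ENNReal.ofReal_ne_top hu.2.ne
  have h2 := ENNReal.toReal_mono hfin h
  rw [ENNReal.toReal_mul, ENNReal.toReal_ofReal (by have := hδ.trans_le hd; positivity)] at h2
  exact (Lp.norm_def (u : L2 Ω)).trans_le
    (h2.trans_eq (congrArg _ (Lp.norm_toLp _ hu).symm))

/-- Smooth functions compactly supported in `Ω` are Lipschitz, hence in the domain, and a function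
orthogonal to all of them vanishes a.e. on `Ω`. -/
theorem IsKernel.dense_grad_domain {e : Metric.sphere (0 : E n) 1} (hω : IsKernel e δ ω)
    (hΩ : IsOpen Ω) (hb : Bornology.IsBounded Ω) :
    Dense ((grad Ω hΩ.measurableSet δ ω).domain : Set (L2 Ω)) := by
  have : IsFiniteMeasure ((volume : Measure (E n)).restrict Ω) :=
    ⟨by simpa using hb.measure_lt_top⟩
  rw [Submodule.dense_iff_topologicalClosure_eq_top, Submodule.topologicalClosure_eq_top_iff,
    Submodule.eq_bot_iff]
  intro f hf
  have hloc : LocallyIntegrableOn f Ω volume :=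
    IntegrableOn.locallyIntegrableOn ((Lp.memLp f).integrable one_le_two)
  have hzero : ∀ᵐ x ∂(volume : Measure (E n)), x ∈ Ω → f x = 0 := by
    refine hΩ.ae_eq_zero_of_integral_contDiff_smul_eq_zero hloc fun g hg hgc hgΩ => ?_
    obtain ⟨L, hL⟩ := hg.lipschitzWith_of_hasCompactSupport hgc (by simp)
    have hsupp : Function.support g ⊆ Ω := (subset_tsupport g).trans hgΩ
    have hgL : MemLp g 2 ((volume : Measure (E n)).restrict Ω) :=
      (hg.continuous.memLp_of_hasCompactSupport hgc).restrict Ω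
    have hmem : hgL.toLp g ∈ (grad Ω hΩ.measurableSet δ ω).domain := by
      rw [mem_grad_domain, memLp_congr_ae (gradFun_congr hΩ.measurableSet _ hgL.coeFn_toLp)]
      refine hω.memLp_gradFun hΩ.measurableSet hb hg.continuous.measurable (L := L) ?_
      rwa [indicator_eq_self.2 hsupp]
    have h := hf _ hmem
    rw [L2.inner_def] at h
    have hs : ∫ x, g x • f x = ∫ x in Ω, g x • f x := by
      refine (setIntegral_eq_integral_of_forall_compl_eq_zero fun x hx => ?_).symm
      rw [Function.notMem_support.1 fun h => hx (hsupp h), zero_smul]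
    rw [hs, ← h]
    refine integral_congr_ae ?_
    filter_upwards [hgL.coeFn_toLp] with x hx
    simp [hx, mul_comm]
  refine Lp.ext ?_
  filter_upwards [(ae_restrict_iff' hΩ.measurableSet).2 hzero,
    Lp.coeFn_zero ℝ 2 ((volume : Measure (E n)).restrict Ω)] with x hx h0
  rw [hx, h0, Pi.zero_apply]

/-- The gradient is given by a pointwise formula, so a.e. convergence along a subsequence identifies
the limit; the limit being in `L²` puts `u` in the domain. -/
theorem isClosed_grad (hΩ : MeasurableSet Ω) : (grad Ω hΩ δ ω).IsClosed := by
  refine IsSeqClosed.isClosed ?_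
  rintro w ⟨u, q⟩ hw hlim
  rw [Prod.tendsto_iff] at hlim
  obtain ⟨hu, hq⟩ := hlim
  set S := enlarge Ω δ ×ˢ enlarge Ω δ
  obtain ⟨a, ha, hae⟩ := (tendstoInMeasure_of_tendsto_Lp hu).exists_seq_tendsto_ae
  -- This subsequence is extracted from the first, so that both components converge a.e. along it.
  obtain ⟨b, hb, hbe⟩ := (tendstoInMeasure_of_tendsto_Lp
    (hq.comp ha.tendsto_atTop)).exists_seq_tendsto_ae
  have hw' : ∀ k, (w k).2 =ᵐ[volume.restrict S] gradFun Ω ω (w k).1 := by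
    intro k
    obtain ⟨x, hx1, hx2⟩ := (LinearPMap.mem_graph_iff _).1 (hw k)
    rw [← hx1, ← hx2]
    exact coeFn_grad hΩ x
  have hind : ∀ᵐ x ∂(volume : Measure (E n)), Filter.Tendsto
      (fun k => Ω.indicator ((w (a (b k))).1) x) Filter.atTop (nhds (Ω.indicator u x)) := by
    filter_upwards [(ae_restrict_iff' hΩ).1 hae] with x hx
    by_cases hxΩ : x ∈ Ω
    · simpa [hxΩ, Function.comp_def] using (hx hxΩ).comp hb.tendsto_atTop
    · simp [hxΩ]
  have hqu : q =ᵐ[volume.restrict S] gradFun Ω ω u := by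
    filter_upwards [hbe, ae_all_iff.2 hw', ae_fst_snd S hind] with z hz1 hz2 hz3
    refine tendsto_nhds_unique hz1 ?_
    simp only [Function.comp_apply, hz2]
    exact (hz3.1.sub hz3.2).mul_const _
  have hmem : u ∈ (grad Ω hΩ δ ω).domain :=
    mem_grad_domain.2 ((memLp_congr_ae hqu).1 (Lp.memLp q))
  refine (LinearPMap.mem_graph_iff _).2 ⟨⟨u, hmem⟩, rfl, Lp.ext ?_⟩
  exact (coeFn_grad hΩ _).trans hqu.symm

theorem Flux.norm_sq (hΩ : MeasurableSet Ω) (q : Flux Ω hΩ δ ω) :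
    ‖q‖ ^ 2 = ‖Flux.incl Ω hΩ δ ω q‖ ^ 2 + ‖Flux.div Ω hΩ δ ω q‖ ^ 2 := by
  rw [← real_inner_self_eq_norm_sq, ← real_inner_self_eq_norm_sq, ← real_inner_self_eq_norm_sq,
    Flux.inner_def]

theorem Flux.norm_incl_le (hΩ : MeasurableSet Ω) (q : Flux Ω hΩ δ ω) :
    ‖Flux.incl Ω hΩ δ ω q‖ ≤ ‖q‖ :=
  le_of_sq_le_sq (by rw [Flux.norm_sq]; nlinarith [sq_nonneg ‖Flux.div Ω hΩ δ ω q‖]) (norm_nonneg q)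

theorem Flux.norm_div_le (hΩ : MeasurableSet Ω) (q : Flux Ω hΩ δ ω) :
    ‖Flux.div Ω hΩ δ ω q‖ ≤ ‖q‖ :=
  le_of_sq_le_sq (by rw [Flux.norm_sq]; nlinarith [sq_nonneg ‖Flux.incl Ω hΩ δ ω q‖])
    (norm_nonneg q)

theorem Flux.norm_le (hΩ : MeasurableSet Ω) (q : Flux Ω hΩ δ ω) :
    ‖q‖ ≤ ‖Flux.incl Ω hΩ δ ω q‖ + ‖Flux.div Ω hΩ δ ω q‖ := by
  refine le_of_sq_le_sq ?_ (by positivity)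
  rw [Flux.norm_sq]
  nlinarith [mul_nonneg (norm_nonneg (Flux.incl Ω hΩ δ ω q)) (norm_nonneg (Flux.div Ω hΩ δ ω q))]

/-- The graph norm is equivalent to the maximum norm on the product, so `Flux` is a copy of the
closed graph of the adjoint. The sign in `g` undoes the one in `div`. -/
theorem Flux.completeSpace (hΩ : MeasurableSet Ω)
    (hd : Dense ((grad Ω hΩ δ ω).domain : Set (L2 Ω))) : CompleteSpace (Flux Ω hΩ δ ω) := by
  let g : Flux Ω hΩ δ ω →ₗ[ℝ] L2Pair Ω δ × L2 Ω :=
    (Flux.incl Ω hΩ δ ω).prod (-Flux.div Ω hΩ δ ω)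
  have hlip : LipschitzWith 1 g := by
    refine LipschitzWith.of_dist_le_mul fun q p => ?_
    rw [dist_eq_norm, dist_eq_norm, ← map_sub, NNReal.coe_one, one_mul, Prod.norm_def]
    refine max_le (Flux.norm_incl_le hΩ _) ?_
    exact (norm_neg _).trans_le (Flux.norm_div_le hΩ _)
  have hanti : AntilipschitzWith 2 g := by
    refine AntilipschitzWith.of_le_mul_dist fun q p => ?_
    rw [dist_eq_norm, dist_eq_norm, ← map_sub]
    have h1 : ‖Flux.incl Ω hΩ δ ω (q - p)‖ ≤ ‖g (q - p)‖ := norm_fst_le (g (q - p))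
    have h2 : ‖Flux.div Ω hΩ δ ω (q - p)‖ ≤ ‖g (q - p)‖ :=
      (norm_neg _).symm.trans_le (norm_snd_le (g (q - p)))
    have h3 := Flux.norm_le hΩ (q - p)
    rw [NNReal.coe_ofNat]
    linarith
  rw [completeSpace_iff_isComplete_range (hanti.isUniformInducing hlip.uniformContinuous)]
  have hrange : range g = ((grad Ω hΩ δ ω).adjoint.graph : Set (L2Pair Ω δ × L2 Ω)) := by
    ext z
    simp only [SetLike.mem_coe, LinearPMap.mem_graph_iff, mem_range]
    constructor
    · rintro ⟨q, rfl⟩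
      exact ⟨q, rfl, (neg_neg _).symm⟩
    · rintro ⟨q, h1, h2⟩
      exact ⟨q, Prod.ext h1 ((neg_neg _).trans h2)⟩
  rw [hrange]
  exact IsClosed.isComplete (LinearPMap.adjoint_isClosed hd)

/-- In `C + 1`, `C` bounds the `L²` norm of `q` and `1` accounts for its divergence `v`. -/
theorem Flux.exists_div_eq (hΩ : MeasurableSet Ω)
    (hd : Dense ((grad Ω hΩ δ ω).domain : Set (L2 Ω))) {C : ℝ} (hC : 0 ≤ C)
    (hG : ∀ u : (grad Ω hΩ δ ω).domain, ‖(u : L2 Ω)‖ ≤ C * ‖grad Ω hΩ δ ω u‖) (v : L2 Ω) :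
    ∃ q : Flux Ω hΩ δ ω, Flux.div Ω hΩ δ ω q = v ∧ ‖q‖ ≤ (C + 1) * ‖v‖ := by
  obtain ⟨q, hq, hqn⟩ := LinearPMap.exists_adjoint_apply_eq hd hC hG (-v)
  have hdiv : Flux.div Ω hΩ δ ω q = v := by
    have : Flux.div Ω hΩ δ ω q = -((grad Ω hΩ δ ω).adjoint q) := rfl
    rw [this, hq, neg_neg]
  refine ⟨q, hdiv, (Flux.norm_le hΩ q).trans ?_⟩
  rw [norm_neg] at hqn
  rw [hdiv, add_mul, one_mul]
  exact add_le_add_left hqn _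

end Operators

end NonlocalDiv

theorem mainTheorem4 {n : ℕ} (hn : 2 ≤ n) (e : Metric.sphere (0 : NonlocalDiv.E n) 1)
    (Ω : Set (NonlocalDiv.E n)) (hΩ : IsOpen Ω) (hb : Bornology.IsBounded Ω)
    (ω : ℝ → NonlocalDiv.E n → ℝ) (hω : ∀ δ : ℝ, 0 < δ → NonlocalDiv.IsKernel e δ (ω δ)) :
    (∀ δ : ℝ, 0 < δ →
      Dense ((NonlocalDiv.grad Ω hΩ.measurableSet δ (ω δ)).domain : Set (NonlocalDiv.L2 Ω)) ∧
      Dense ((NonlocalDiv.div Ω hΩ.measurableSet δ (ω δ)).domain :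
        Set (NonlocalDiv.L2Pair Ω δ)) ∧
      CompleteSpace (NonlocalDiv.Flux Ω hΩ.measurableSet δ (ω δ)) ∧
      IsBoundedLinearMap ℝ (NonlocalDiv.Flux.div Ω hΩ.measurableSet δ (ω δ)) ∧
      Function.Surjective (NonlocalDiv.Flux.div Ω hΩ.measurableSet δ (ω δ))) ∧
    (∀ δbar : ℝ, 0 < δbar → ∃ C : ℝ, 0 < C ∧
      ∀ v : NonlocalDiv.L2 Ω, ∀ δ : ℝ, 0 < δ → δ < δbar →
        ∃ q : NonlocalDiv.Flux Ω hΩ.measurableSet δ (ω δ),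
          NonlocalDiv.Flux.div Ω hΩ.measurableSet δ (ω δ) q = v ∧ ‖q‖ ≤ C * ‖v‖) := by
  have hgrad : ∀ δ : ℝ, 0 < δ →
      Dense ((NonlocalDiv.grad Ω hΩ.measurableSet δ (ω δ)).domain : Set (NonlocalDiv.L2 Ω)) :=
    fun δ hδ => (hω δ hδ).dense_grad_domain hΩ hb
  obtain ⟨R, hR, hΩR⟩ := hb.subset_ball_lt 0 0
  -- Allowing `δ = d` yields surjectivity at a fixed horizon as well as the uniform bound.
  have hdiv : ∀ d : ℝ, 0 < d → ∃ C : ℝ, 0 < C ∧ ∀ v : NonlocalDiv.L2 Ω, ∀ δ : ℝ, 0 < δ → δ ≤ d →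
      ∃ q : NonlocalDiv.Flux Ω hΩ.measurableSet δ (ω δ),
        NonlocalDiv.Flux.div Ω hΩ.measurableSet δ (ω δ) q = v ∧ ‖q‖ ≤ C * ‖v‖ := by
    intro d hd
    refine ⟨√(NonlocalDiv.sphereConst 2 e) * (2 * R + d) + 1, by positivity,
      fun v δ hδ hδd => ?_⟩
    exact NonlocalDiv.Flux.exists_div_eq hΩ.measurableSet (hgrad δ hδ) (by positivity)
      ((hω δ hδ).norm_le_norm_grad hδ hΩ.measurableSet hR hΩR hδd) v
  refine ⟨fun δ hδ => ⟨hgrad δ hδ, ?_, ?_, ?_, ?_⟩, fun d hd => ?_⟩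
  · exact (NonlocalDiv.isClosed_grad hΩ.measurableSet).dense_adjoint_domain
  · exact NonlocalDiv.Flux.completeSpace hΩ.measurableSet (hgrad δ hδ)
  · refine (NonlocalDiv.Flux.div Ω hΩ.measurableSet δ (ω δ)).isLinear.with_bound 1 fun q => ?_
    rw [one_mul]
    exact NonlocalDiv.Flux.norm_div_le hΩ.measurableSet q
  · intro v
    obtain ⟨C, -, hC⟩ := hdiv δ hδ
    obtain ⟨q, hq, -⟩ := hC v δ hδ le_rfl
    exact ⟨q, hq⟩
  · obtain ⟨C, hC0, hC⟩ := hdiv d hd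
    exact ⟨C, hC0, fun v δ hδ hδd => hC v δ hδ hδd.le⟩
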